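/- All graphs are finite, simple and undirected. The growth of a graph $G$ is the function $f_G$ that assigns to each integer $r\ge 1$ the maximum number of vertices of a subgraph $H$ of $G$ with radius at most $r$ (where distances are measured in $H$). A graph $G$ is a minor of a graph $\tilde G$ if $G$ is isomorphic to a graph obtained from a subgraph of $\tilde G$ by contracting edges. Corollary. For every integer $k\ge 1$, every real $\varepsilon>0$ and every graph $G$ with treewidth less than $k$, there is a graph $\tilde G$ such that $G$ is a minor of $\tilde G$ and $$f_{\tilde G}(r)\le \bigl(162(k+1)+\varepsilon\bigr)\,r+1\qquad\text{for every integer } r\ge 1.$$ -/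

import Mathlib

open scoped ENNReal

universe u v

/-- A tree-decomposition of `G` indexed by the nodes of a graph `T` (which is a tree): every edge has
both its ends in some bag, and for every vertex `v` the nodes whose bag contains `v` induce a
nonempty connected subgraph of `T` (`SimpleGraph.Connected` includes nonemptiness), that is, a
nonempty subtree of `T`. -/
structure SimpleGraph.TreeDecomposition {V : Type u} (G : SimpleGraph V) {N : Type v}
    (T : SimpleGraph N) where
  isTree : T.IsTree
  bag : N → Set V
  exists_bag_of_adj : ∀ ⦃a b : V⦄, G.Adj a b → ∃ x : N, a ∈ bag x ∧ b ∈ bag x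
  connected_nodes : ∀ w : V, (T.induce {x : N | w ∈ bag x}).Connected

/-- The width of a tree-decomposition: the size of the largest bag, minus one. (Subtraction in `ℕ∞`
is truncated, so a decomposition of the graph without vertices gets width `0` instead of `-1`.) -/
noncomputable def SimpleGraph.TreeDecomposition.width {V : Type u} {G : SimpleGraph V} {N : Type v}
    {T : SimpleGraph N} (D : G.TreeDecomposition T) : ℕ∞ :=
  (⨆ x : N, (D.bag x).encard) - 1

/-- The treewidth of `G`: the smallest width of a tree-decomposition of `G`. -/
noncomputable def SimpleGraph.treewidth {V : Type u} (G : SimpleGraph V) : ℕ∞ :=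
  ⨅ (N : Type u) (T : SimpleGraph N) (D : G.TreeDecomposition T), D.width

/-- The growth of `G`: the supremum of the number of vertices of `H`, over all subgraphs `H` of `G`
of radius at most `r` (distances being measured in `H`). -/
noncomputable def SimpleGraph.growth {V : Type u} (G : SimpleGraph V) (r : ℕ) : ℕ∞ :=
  ⨆ (H : G.Subgraph) (_ : H.coe.radius ≤ (r : ℕ∞)), H.verts.encard

/-- The simple graph obtained from `H` by contracting all the edges of `F` (to be used for `F ≤ H`):
its vertices are the connected components of the graph on the same vertices with edge set `F`, and
two distinct ones are adjacent if `H` has an edge between them. -/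
def SimpleGraph.contractEdges {V : Type u} (H F : SimpleGraph V) :
    SimpleGraph F.ConnectedComponent where
  Adj C D := C ≠ D ∧ ∃ a b : V,
    F.connectedComponentMk a = C ∧ F.connectedComponentMk b = D ∧ H.Adj a b
  symm := ⟨fun _ _ ⟨hne, a, b, ha, hb, h⟩ => ⟨hne.symm, b, a, hb, ha, h.symm⟩⟩
  loopless := ⟨fun _ h => h.1 rfl⟩

/-- `G` is a minor of `G'`: it is isomorphic to a graph obtained from a subgraph `S` of `G'` by
contracting edges. -/
def SimpleGraph.IsMinor {V : Type u} {W : Type v} (G : SimpleGraph V) (G' : SimpleGraph W) : Prop :=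
  ∃ (S : G'.Subgraph) (F : SimpleGraph S.verts),
    F ≤ S.coe ∧ Nonempty (G ≃g S.coe.contractEdges F)

/-! Arrange the bags of a tree-decomposition in a binary tree and lengthen its edges until every
ball of radius r has at most 5r + 1 nodes. Put a copy of G[B] at each node with bag B and join
copies of a vertex at adjacent nodes. Contracting these joins gives back G, because the nodes
holding a vertex are connected. Projection to the tree does not increase distances, so a subgraph of
radius at most r lies over a ball and has at most (5r + 1)k ≤ 6kr vertices, well below the required
bound.

The binary tree (`exists_bagTree`) is built by adding the vertices by increasing depth of their top
nodes, each with one new leaf. Linear growth (`linearGrowth_node`) is an induction: the paths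
inserted above two subtrees are at least twice as long as the subtrees' total size, so a ball that
meets the new root and also reaches a subtree has a radius that pays for both subtrees. -/

/-- A binary tree whose nodes carry subsets of `α`, called bags. -/
inductive BagTree (α : Type u) : Type u
  | empty : BagTree α
  | node (A : Set α) (l r : BagTree α) : BagTree α

/-! ### Distances in the binary tree -/

/-- The distance between two nodes of the infinite binary tree, given by their addresses. -/
def addressDist : List Bool → List Bool → ℕ
  | [], b => b.length
  | x :: a, [] => (x :: a).length
  | x :: a, y :: b => if x = y then addressDist a b else a.length + b.length + 2

@[simp] theorem addressDist_nil_left (b : List Bool) : addressDist [] b = b.length := by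
  cases b <;> rfl

@[simp] theorem addressDist_nil_right (a : List Bool) : addressDist a [] = a.length := by
  cases a <;> rfl

@[simp] theorem addressDist_cons_self (x : Bool) (a b : List Bool) :
    addressDist (x :: a) (x :: b) = addressDist a b := by
  simp [addressDist]

theorem addressDist_cons_of_ne {x y : Bool} (h : x ≠ y) (a b : List Bool) :
    addressDist (x :: a) (y :: b) = a.length + b.length + 2 := by
  simp [addressDist, h]

@[simp] theorem addressDist_self (a : List Bool) : addressDist a a = 0 := by
  induction a with
  | nil => rfl
  | cons x a ih => simpa using ih

theorem length_le_addressDist_add (c a : List Bool) : a.length ≤ addressDist c a + c.length := by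
  induction c generalizing a with
  | nil => simp
  | cons x c ih =>
    cases a with
    | nil => simp
    | cons y a =>
      by_cases h : x = y
      · subst h
        have := ih a
        simp only [addressDist_cons_self, List.length_cons]
        omega
      · rw [addressDist_cons_of_ne h]
        simp only [List.length_cons]
        omega

theorem addressDist_concat (c a : List Bool) (x : Bool) :
    addressDist c (a ++ [x]) ≤ addressDist c a + 1 ∧
      addressDist c a ≤ addressDist c (a ++ [x]) + 1 := by
  induction c generalizing a with
  | nil => simp; omega
  | cons y c ih =>
    cases a with
    | nil =>
      by_cases h : y = x
      · subst h; simp; omega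
      · simp [addressDist_cons_of_ne h]
    | cons z a =>
      by_cases h : y = z
      · subst h; simpa using ih a
      · simp [addressDist_cons_of_ne h]; omega

/-! ### Valid trees of bags -/

namespace BagTree

variable {α : Type u}

/-- The set of all bags. -/
def bags : BagTree α → Set (Set α)
  | empty => ∅
  | node A l r => insert A (l.bags ∪ r.bags)

/-- The elements of the bags. -/
def support (t : BagTree α) : Set α := ⋃₀ t.bags

/-- The bag at the root. -/
def root : BagTree α → Set α
  | empty => ∅
  | node A _ _ => A

/-- The nodes whose bag contains a given element induce a subtree. -/
def IsValid : BagTree α → Prop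
  | empty => True
  | node A l r => l.IsValid ∧ r.IsValid ∧ l.support ∩ r.support ⊆ A ∧
      A ∩ l.support ⊆ l.root ∧ A ∩ r.support ⊆ r.root

/-- The bag at a given address. -/
def bagAt : BagTree α → List Bool → Set α
  | empty, _ => ∅
  | node A _ _, [] => A
  | node _ l _, false :: a => l.bagAt a
  | node _ _ r, true :: a => r.bagAt a

/-- The addresses of the nodes. -/
def addresses : BagTree α → Finset (List Bool)
  | empty => ∅
  | node _ l r =>
    insert [] (l.addresses.image (List.cons false) ∪ r.addresses.image (List.cons true))

@[simp] theorem bags_empty : (empty : BagTree α).bags = ∅ := rfl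

@[simp] theorem bags_node (A : Set α) (l r : BagTree α) :
    (node A l r).bags = insert A (l.bags ∪ r.bags) := rfl

@[simp] theorem support_empty : (empty : BagTree α).support = ∅ := by simp [support]

@[simp] theorem support_node (A : Set α) (l r : BagTree α) :
    (node A l r).support = A ∪ (l.support ∪ r.support) := by
  simp [support, Set.sUnion_insert, Set.sUnion_union]

@[simp] theorem root_empty : (empty : BagTree α).root = ∅ := rfl

@[simp] theorem root_node (A : Set α) (l r : BagTree α) : (node A l r).root = A := rfl

@[simp] theorem isValid_empty : (empty : BagTree α).IsValid := trivial

theorem isValid_node {A : Set α} {l r : BagTree α} :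
    (node A l r).IsValid ↔ l.IsValid ∧ r.IsValid ∧ l.support ∩ r.support ⊆ A ∧
      A ∩ l.support ⊆ l.root ∧ A ∩ r.support ⊆ r.root := Iff.rfl

theorem bagAt_nil (t : BagTree α) : t.bagAt [] = t.root := by
  cases t <;> rfl

@[simp] theorem bagAt_node_nil (A : Set α) (l r : BagTree α) : (node A l r).bagAt [] = A := rfl

@[simp] theorem bagAt_empty (a : List Bool) : (empty : BagTree α).bagAt a = ∅ := rfl

theorem mem_bags_iff {t : BagTree α} {B : Set α} :
    B ∈ t.bags ↔ ∃ a ∈ t.addresses, t.bagAt a = B := by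
  induction t with
  | empty => simp [addresses]
  | node A l r ihl ihr =>
    simp only [bags_node, Set.mem_insert_iff, Set.mem_union, ihl, ihr, addresses,
      Finset.mem_insert, Finset.mem_union, Finset.mem_image]
    constructor
    · rintro (rfl | ⟨a, ha, rfl⟩ | ⟨a, ha, rfl⟩)
      · exact ⟨[], Or.inl rfl, rfl⟩
      · exact ⟨false :: a, Or.inr (Or.inl ⟨a, ha, rfl⟩), rfl⟩
      · exact ⟨true :: a, Or.inr (Or.inr ⟨a, ha, rfl⟩), rfl⟩
    · rintro ⟨_, rfl | ⟨a, ha, rfl⟩ | ⟨a, ha, rfl⟩, rfl⟩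
      · exact Or.inl rfl
      · exact Or.inr (Or.inl ⟨a, ha, rfl⟩)
      · exact Or.inr (Or.inr ⟨a, ha, rfl⟩)

theorem mem_support_of_mem_bagAt {t : BagTree α} {a : List Bool} {x : α} (h : x ∈ t.bagAt a) :
    x ∈ t.support := by
  induction t generalizing a with
  | empty => simp at h
  | node A l r ihl ihr =>
    rcases a with _ | ⟨_ | _, a⟩
    · simpa using Or.inl h
    · simpa using Or.inr (Or.inl (ihl h))
    · simpa using Or.inr (Or.inr (ihr h))

theorem mem_addresses_of_mem_bagAt {t : BagTree α} {a : List Bool} {x : α} (h : x ∈ t.bagAt a) :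
    a ∈ t.addresses := by
  induction t generalizing a with
  | empty => simp at h
  | node A l r ihl ihr =>
    rcases a with _ | ⟨_ | _, a⟩
    · simp [addresses]
    · simpa [addresses] using ihl h
    · simpa [addresses] using ihr h

theorem exists_mem_bagAt {t : BagTree α} {x : α} (h : x ∈ t.support) : ∃ a, x ∈ t.bagAt a := by
  obtain ⟨B, hB, hx⟩ := h
  obtain ⟨a, -, rfl⟩ := mem_bags_iff.1 hB
  exact ⟨a, hx⟩

/-- A new leaf whose bag consists of a new element and a part of an existing bag can be added. -/
theorem IsValid.exists_attach {t : BagTree α} (ht : t.IsValid) {X Y : Set α} (hY : Y ∈ t.bags)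
    (hXY : X ⊆ Y) {x : α} (hx : x ∉ t.support) :
    ∃ t' : BagTree α, t'.IsValid ∧ t'.root = t.root ∧ t'.bags = insert (insert x X) t.bags := by
  induction t with
  | empty => simp at hY
  | node A l r ihl ihr =>
    have support_eq {s s' : BagTree α} (h : s'.bags = insert (insert x X) s.bags)
        (hs : Y ∈ s.bags) : s'.support = insert x s.support := by
      have hX : X ⊆ s.support := fun y hy => ⟨Y, hs, hXY hy⟩
      simp only [support, h, Set.sUnion_insert]
      ext y
      simp only [Set.mem_union, Set.mem_insert_iff]
      have := @hX y
      simp only [support] at this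
      tauto
    obtain ⟨hl, hr, hlr, hAl, hAr⟩ := isValid_node.1 ht
    simp only [support_node, Set.mem_union, not_or] at hx
    obtain ⟨hxA, hxl, hxr⟩ := hx
    rcases hY with rfl | hY | hY
    -- The node with bag `Y` is doubled: the upper copy has a free child for the new leaf, so the
    -- tree stays binary.
    · refine ⟨node Y (node Y l r) (node (insert x X) empty empty), ?_, rfl, ?_⟩
      · refine isValid_node.2 ⟨ht, ?_, ?_, ?_, ?_⟩
        · simp [isValid_node]
        · rintro y ⟨hy, hy'⟩
          simp only [support_node, support_empty, Set.union_empty] at hy hy'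
          rcases hy' with rfl | hy'
          · rcases hy with h | h | h <;> contradiction
          · exact hXY hy'
        · exact Set.inter_subset_left
        · simp
      · ext B; simp
    · obtain ⟨t', h1, h2, h3⟩ := ihl hl hY hxl
      refine ⟨node A t' r, isValid_node.2 ⟨h1, hr, ?_, ?_, hAr⟩, rfl, ?_⟩
      · rw [support_eq h3 hY]
        rintro y ⟨rfl | hy, hy'⟩
        · contradiction
        · exact hlr ⟨hy, hy'⟩
      · rw [support_eq h3 hY, h2]
        rintro y ⟨hy', rfl | hy⟩
        · contradiction
        · exact hAl ⟨hy', hy⟩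
      · ext B; simp [h3]; tauto
    · obtain ⟨t', h1, h2, h3⟩ := ihr hr hY hxr
      refine ⟨node A l t', isValid_node.2 ⟨hl, h1, ?_, hAl, ?_⟩, rfl, ?_⟩
      · rw [support_eq h3 hY]
        rintro y ⟨hy', rfl | hy⟩
        · contradiction
        · exact hlr ⟨hy', hy⟩
      · rw [support_eq h3 hY, h2]
        rintro y ⟨hy', rfl | hy⟩
        · contradiction
        · exact hAr ⟨hy', hy⟩
      · ext B; simp [h3]; tauto

/-! ### Counting nodes and stretching edges -/

/-- The number of nodes whose addresses satisfy `P`. -/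
def count (t : BagTree α) (P : List Bool → Prop) [DecidablePred P] : ℕ :=
  (t.addresses.filter P).card

@[simp] theorem count_empty (P : List Bool → Prop) [DecidablePred P] :
    (empty : BagTree α).count P = 0 := rfl

theorem count_node (A : Set α) (l r : BagTree α) (P : List Bool → Prop) [DecidablePred P] :
    (node A l r).count P = (if P [] then 1 else 0) + l.count (fun a => P (false :: a)) +
      r.count (fun a => P (true :: a)) := by
  simp only [count, addresses, Finset.filter_insert, Finset.filter_union, Finset.filter_image]
  have hd : Disjoint ((l.addresses.filter fun a => P (false :: a)).image (List.cons false))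
      ((r.addresses.filter fun a => P (true :: a)).image (List.cons true)) := by
    rw [Finset.disjoint_left]
    simp only [Finset.mem_image]
    rintro _ ⟨a, -, rfl⟩ ⟨b, -, h⟩
    simp at h
  have hc := Finset.card_union_of_disjoint hd
  rw [Finset.card_image_of_injective _ List.cons_injective,
    Finset.card_image_of_injective _ List.cons_injective] at hc
  split_ifs
  · rw [Finset.card_insert_of_notMem (by simp), hc]
    omega
  · rw [hc]
    omega

theorem count_mono (t : BagTree α) {P Q : List Bool → Prop} [DecidablePred P] [DecidablePred Q]
    (h : ∀ a, P a → Q a) : t.count P ≤ t.count Q :=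
  Finset.card_le_card (Finset.monotone_filter_right _ fun a _ => h a)

theorem count_le_card (t : BagTree α) (P : List Bool → Prop) [DecidablePred P] :
    t.count P ≤ t.addresses.card :=
  Finset.card_filter_le _ _

theorem count_eq_zero (t : BagTree α) {P : List Bool → Prop} [DecidablePred P]
    (h : ∀ a, ¬ P a) : t.count P = 0 := by
  simp [count, h]

/-- Put a path of `n` nodes with bag `A` on top of `t`. -/
def extend (A : Set α) (t : BagTree α) : ℕ → BagTree α
  | 0 => t
  | n + 1 => node A (t.extend A n) empty

/-- Lengthen the edges, so that balls grow linearly. -/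
def stretch : BagTree α → BagTree α
  | empty => empty
  | node A l r =>
    node A (l.stretch.extend A (2 * (l.stretch.addresses.card + r.stretch.addresses.card)))
      (r.stretch.extend A (2 * (l.stretch.addresses.card + r.stretch.addresses.card)))

theorem bags_extend_subset (A : Set α) (t : BagTree α) (n : ℕ) :
    (t.extend A n).bags ⊆ insert A t.bags ∧ t.bags ⊆ (t.extend A n).bags := by
  induction n with
  | zero => simp [extend]
  | succ n ih =>
    obtain ⟨h1, h2⟩ := ih
    constructor
    · simpa [extend, Set.insert_subset_iff] using h1
    · simpa [extend] using h2.trans (Set.subset_insert _ _)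

theorem bags_stretch (t : BagTree α) : t.stretch.bags = t.bags := by
  induction t with
  | empty => rfl
  | node A l r ihl ihr =>
    simp only [stretch, bags_node]
    set n := 2 * (l.stretch.addresses.card + r.stretch.addresses.card)
    have h1 := bags_extend_subset A l.stretch n
    have h2 := bags_extend_subset A r.stretch n
    rw [ihl] at h1
    rw [ihr] at h2
    ext B
    have a1 := @h1.1 B
    have a2 := @h1.2 B
    have a3 := @h2.1 B
    have a4 := @h2.2 B
    simp only [Set.mem_insert_iff, Set.mem_union] at *
    tauto

theorem support_stretch (t : BagTree α) : t.stretch.support = t.support := by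
  simp [support, bags_stretch]

theorem root_stretch (t : BagTree α) : t.stretch.root = t.root := by
  cases t <;> rfl

/-- The second conjunct is the condition for putting one more node with bag `A` on top, so it must
be carried through the induction. -/
theorem IsValid.extend {A : Set α} {t : BagTree α} (ht : t.IsValid) (h : A ∩ t.support ⊆ t.root)
    (n : ℕ) : (t.extend A n).IsValid ∧ A ∩ (t.extend A n).support ⊆ (t.extend A n).root := by
  induction n with
  | zero => exact ⟨ht, h⟩
  | succ n ih => simpa [BagTree.extend, isValid_node] using ih

theorem IsValid.stretch {t : BagTree α} (ht : t.IsValid) : t.stretch.IsValid := by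
  induction t with
  | empty => trivial
  | node A l r ihl ihr =>
    obtain ⟨hl, hr, hlr, hAl, hAr⟩ := isValid_node.1 ht
    rw [BagTree.stretch]
    set n := 2 * (l.stretch.addresses.card + r.stretch.addresses.card)
    rw [← l.support_stretch, ← l.root_stretch] at hAl
    rw [← r.support_stretch, ← r.root_stretch] at hAr
    obtain ⟨h1, h2⟩ := (ihl hl).extend hAl n
    obtain ⟨h3, h4⟩ := (ihr hr).extend hAr n
    refine isValid_node.2 ⟨h1, h3, ?_, h2, h4⟩
    rintro x ⟨hx, hx'⟩
    have e1 := Set.sUnion_mono (bags_extend_subset A l.stretch n).1 hx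
    have e2 := Set.sUnion_mono (bags_extend_subset A r.stretch n).1 hx'
    rw [Set.sUnion_insert] at e1 e2
    rcases e1 with h | e1
    · exact h
    rcases e2 with h | e2
    · exact h
    rw [bags_stretch] at e1 e2
    exact hlr ⟨e1, e2⟩

/-! ### Linear growth -/

/-- Balls have linear size, even after a ray has been attached to the root. -/
def LinearGrowth (t : BagTree α) : Prop :=
  ∀ c ∈ t.addresses, ∀ r : ℕ, t.count (fun a => addressDist c a ≤ r) + (r - c.length) ≤ 5 * r + 1

theorem nil_mem_addresses {t : BagTree α} (h : t.addresses.Nonempty) : [] ∈ t.addresses := by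
  cases t <;> simp_all [addresses]

/-- Around the root the ray accounts for r of the 5r + 1. -/
theorem LinearGrowth.count_length_le {t : BagTree α} (ht : t.LinearGrowth) (r : ℕ) :
    t.count (fun a => a.length ≤ r) ≤ 4 * r + 1 := by
  rcases t.addresses.eq_empty_or_nonempty with h | h
  · simp [count, h]
  · have := ht [] (nil_mem_addresses h) r
    simp only [addressDist_nil_left, List.length_nil] at this
    omega

/-- A node put on top takes the place of the first node of the ray, so balls around old nodes keep
the same total. Around the new node, the bound with 4 in place of 5 leaves room for the ray. -/
theorem LinearGrowth.extend {A : Set α} {t : BagTree α} (ht : t.LinearGrowth) (n : ℕ) :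
    (t.extend A n).LinearGrowth := by
  induction n with
  | zero => exact ht
  | succ n ih =>
    intro c hc r
    simp only [BagTree.extend, addresses, Finset.image_empty, Finset.union_empty,
      Finset.mem_insert, Finset.mem_image] at hc
    rw [BagTree.extend, count_node, count_empty]
    rcases hc with rfl | ⟨c, hc, rfl⟩
    · simp only [addressDist_nil_left, List.length_nil, List.length_cons, zero_le, if_true]
      rcases r with _ | r
      · simp [count_eq_zero]
      · have := ih.count_length_le r
        simp only [Nat.add_le_add_iff_right]
        omega
    · have := ih c hc r
      simp only [addressDist_nil_right, addressDist_cons_self, List.length_cons]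
      split_ifs <;> omega

theorem count_length_extend_le (A : Set α) (t : BagTree α) (n s : ℕ) :
    (t.extend A n).count (fun a => a.length ≤ s) ≤
      s + 1 + if n ≤ s then t.addresses.card else 0 := by
  induction n generalizing s with
  | zero =>
    have := t.count_le_card (fun a => a.length ≤ s)
    simp only [extend, zero_le, if_true]
    omega
  | succ n ih =>
    rw [extend, count_node, count_empty]
    rcases s with _ | s
    · simp [count_eq_zero]
    · have := ih s
      simp only [List.length_nil, List.length_cons, Nat.add_le_add_iff_right, zero_le, if_true]
      omega

theorem linearGrowth_node {A : Set α} {l r : BagTree α} (hl : l.LinearGrowth)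
    (hr : r.LinearGrowth) {n : ℕ} (hn : 2 * (l.addresses.card + r.addresses.card) ≤ n) :
    (node A (l.extend A n) (r.extend A n)).LinearGrowth := by
  have side {s s' : BagTree α} (hs : s.LinearGrowth)
      (hn : 2 * (s.addresses.card + s'.addresses.card) ≤ n)
      {c : List Bool} (hc : c ∈ (s.extend A n).addresses) (q : ℕ) :
      (if c.length + 1 ≤ q then 1 else 0) + (s.extend A n).count (fun a => addressDist c a ≤ q) +
        (s'.extend A n).count (fun a => c.length + a.length + 2 ≤ q) + (q - (c.length + 1)) ≤
          5 * q + 1 := by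
    by_cases h : c.length + 1 ≤ q
    -- The centre has depth at most q - 1 in its side, so the ball stays within depth 2q - 1 there.
    · have h1 : (s.extend A n).count (fun a => addressDist c a ≤ q) ≤
          (s.extend A n).count (fun a => a.length ≤ 2 * q - 1) := by
        apply count_mono
        intro a ha
        have := length_le_addressDist_add c a
        omega
      have h2 : (s'.extend A n).count (fun a => c.length + a.length + 2 ≤ q) ≤
          (s'.extend A n).count (fun a => a.length ≤ q - 1) := by
        apply count_mono
        intro a ha
        omega
      have h3 := count_length_extend_le A s n (2 * q - 1)
      have h4 := count_length_extend_le A s' n (q - 1)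
      rw [if_pos h]
      -- The root, the two paths and the ray give at most 1 + 2q + q + (q - 1) = 4q. A subtree
      -- counts only if n ≤ 2q - 1, and then both subtrees together have fewer than q nodes.
      split_ifs at h3 h4 <;> omega
    -- The ball misses the root, hence also the other side and the ray.
    · have h1 := hs.extend (A := A) n c hc q
      rw [count_eq_zero (s'.extend A n) (by intro a; omega), if_neg h]
      omega
  intro c hc q
  rw [count_node]
  simp only [addresses, Finset.mem_insert, Finset.mem_union, Finset.mem_image] at hc
  rcases hc with rfl | ⟨c, hc, rfl⟩ | ⟨c, hc, rfl⟩
  · simp only [addressDist_nil_left, List.length_nil, List.length_cons, zero_le, if_true]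
    rcases q with _ | q
    · simp [count_eq_zero]
    · have h3 := count_length_extend_le A l n q
      have h4 := count_length_extend_le A r n q
      simp only [Nat.add_le_add_iff_right]
      split_ifs at h3 h4 <;> omega
  · have := side (s' := r) hl hn hc q
    simpa [addressDist_cons_of_ne] using this
  · have := side (s' := l) hr (by omega) hc q
    simp only [addressDist_nil_right, addressDist_cons_self, List.length_cons, ne_eq,
      Bool.true_eq_false, not_false_eq_true, addressDist_cons_of_ne]
    omega

theorem linearGrowth_stretch (t : BagTree α) : t.stretch.LinearGrowth := by
  induction t with
  | empty => simp [LinearGrowth, stretch, addresses]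
  | node A l r ihl ihr => exact linearGrowth_node ihl ihr le_rfl

end BagTree

/-! ### Minors from fibres -/

namespace SimpleGraph

/-- The components of `F` are the fibres of `f`, so `f` identifies the contracted vertices with `V`;
nothing is deleted. -/
theorem isMinor_of_fibers {V : Type u} {W : Type v} {G : SimpleGraph V} {G' F : SimpleGraph W}
    (hF : F ≤ G') {f : W → V} (hf : f.Surjective) (hfF : ∀ p q, F.Reachable p q ↔ f p = f q)
    (hadj : ∀ x y, G.Adj x y ↔ x ≠ y ∧ ∃ p q, f p = x ∧ f q = y ∧ G'.Adj p q) :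
    G.IsMinor G' := by
  let F' : SimpleGraph (⊤ : G'.Subgraph).verts := F.comap Subtype.val
  let up : F →g F' := ⟨fun p => ⟨p, trivial⟩, fun h => h⟩
  let down : F' →g F := ⟨Subtype.val, fun h => h⟩
  have key (p q : (⊤ : G'.Subgraph).verts) : F'.Reachable p q ↔ f p.1 = f q.1 :=
    ⟨fun h => (hfF _ _).1 (h.map down), fun h => ((hfF _ _).2 h).map up⟩
  let g : F'.ConnectedComponent → V :=
    ConnectedComponent.lift (fun p => f p.1) fun p q w _ => (key p q).1 w.reachable
  have hg : g.Bijective := by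
    constructor
    · intro C D
      induction C using ConnectedComponent.ind with | _ p
      induction D using ConnectedComponent.ind with | _ q
      exact fun h => ConnectedComponent.sound ((key p q).2 h)
    · intro x
      obtain ⟨p, rfl⟩ := hf x
      exact ⟨F'.connectedComponentMk ⟨p, trivial⟩, rfl⟩
  refine ⟨⊤, F', fun p q h => hF h, ⟨RelIso.symm ⟨Equiv.ofBijective g hg, ?_⟩⟩⟩
  intro C D
  simp only [Equiv.ofBijective_apply, hadj, contractEdges, hg.1.ne_iff]
  refine and_congr_right fun _ => ⟨?_, ?_⟩
  · rintro ⟨p, q, hp, hq, h⟩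
    exact ⟨⟨p, trivial⟩, ⟨q, trivial⟩, hg.1 hp, hg.1 hq, h⟩
  · rintro ⟨p, q, rfl, rfl, h⟩
    exact ⟨p.1, q.1, rfl, rfl, h⟩

theorem IsMinor.of_iso {V : Type u} {V' : Type*} {W : Type v} {G : SimpleGraph V}
    {G₀ : SimpleGraph V'} {G' : SimpleGraph W} (e : G ≃g G₀) (h : G₀.IsMinor G') :
    G.IsMinor G' := by
  obtain ⟨S, F, hF, ⟨i⟩⟩ := h
  exact ⟨S, F, hF, ⟨e.trans i⟩⟩

end SimpleGraph

/-! ### The host graph and its growth -/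

namespace BagTree

variable {α : Type u}

/-- The pairs of a node and an element of its bag. -/
abbrev Point (t : BagTree α) : Type u := {p : List Bool × α // p.2 ∈ t.bagAt p.1}

/-- Copies of the same element at adjacent nodes are joined. -/
def copyGraph (t : BagTree α) : SimpleGraph t.Point where
  Adj p q := p.1.2 = q.1.2 ∧ ((∃ b, q.1.1 = p.1.1 ++ [b]) ∨ ∃ b, p.1.1 = q.1.1 ++ [b])
  symm := ⟨fun _ _ h => ⟨h.1.symm, h.2.symm⟩⟩
  loopless := ⟨by rintro p ⟨-, ⟨b, h⟩ | ⟨b, h⟩⟩ <;> simp at h⟩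

/-- Every bag carries a copy of the subgraph of `G` that it induces, and copies of the same element
at adjacent nodes are joined. -/
def hostGraph (t : BagTree α) (G : SimpleGraph α) : SimpleGraph t.Point where
  Adj p q := (p.1.1 = q.1.1 ∧ G.Adj p.1.2 q.1.2) ∨ t.copyGraph.Adj p q
  symm := ⟨fun _ _ h => h.imp (fun h => ⟨h.1.symm, h.2.symm⟩) fun h => h.symm⟩
  loopless := ⟨fun _ h => h.elim (fun h => G.loopless.irrefl _ h.2) fun h => h.ne rfl⟩

/-- The inclusion of the left subtree. -/
def copyGraphHomLeft (A : Set α) (l r : BagTree α) : l.copyGraph →g (node A l r).copyGraph where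
  toFun p := ⟨(false :: p.1.1, p.1.2), p.2⟩
  map_rel' := by
    rintro p q ⟨h1, ⟨b, h⟩ | ⟨b, h⟩⟩
    · exact ⟨h1, Or.inl ⟨b, by simp [h]⟩⟩
    · exact ⟨h1, Or.inr ⟨b, by simp [h]⟩⟩

/-- The inclusion of the right subtree. -/
def copyGraphHomRight (A : Set α) (l r : BagTree α) : r.copyGraph →g (node A l r).copyGraph where
  toFun p := ⟨(true :: p.1.1, p.1.2), p.2⟩
  map_rel' := by
    rintro p q ⟨h1, ⟨b, h⟩ | ⟨b, h⟩⟩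
    · exact ⟨h1, Or.inl ⟨b, by simp [h]⟩⟩
    · exact ⟨h1, Or.inr ⟨b, by simp [h]⟩⟩

theorem IsValid.reachable_root {t : BagTree α} (ht : t.IsValid) {x : α} {a : List Bool}
    (hx : x ∈ t.bagAt []) (ha : x ∈ t.bagAt a) :
    t.copyGraph.Reachable ⟨(a, x), ha⟩ ⟨([], x), hx⟩ := by
  induction t generalizing a with
  | empty => simp at hx
  | node A l r ihl ihr =>
    obtain ⟨hl, hr, -, hAl, hAr⟩ := isValid_node.1 ht
    rcases a with _ | ⟨_ | _, a⟩
    · rfl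
    · have h0 : x ∈ l.bagAt [] := by
        rw [bagAt_nil]
        exact hAl ⟨hx, mem_support_of_mem_bagAt (t := l) ha⟩
      refine ((ihl hl h0 ha).map (copyGraphHomLeft A l r)).trans (SimpleGraph.Adj.reachable ?_)
      exact ⟨rfl, Or.inr ⟨false, rfl⟩⟩
    · have h0 : x ∈ r.bagAt [] := by
        rw [bagAt_nil]
        exact hAr ⟨hx, mem_support_of_mem_bagAt (t := r) ha⟩
      refine ((ihr hr h0 ha).map (copyGraphHomRight A l r)).trans (SimpleGraph.Adj.reachable ?_)
      exact ⟨rfl, Or.inr ⟨true, rfl⟩⟩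

/-- Copies of an element of the root bag are connected through the root. Any other element occurs on
one side only, where induction applies. -/
theorem IsValid.reachable {t : BagTree α} (ht : t.IsValid) {x : α} {a b : List Bool}
    (ha : x ∈ t.bagAt a) (hb : x ∈ t.bagAt b) :
    t.copyGraph.Reachable ⟨(a, x), ha⟩ ⟨(b, x), hb⟩ := by
  induction t generalizing a b with
  | empty => simp at ha
  | node A l r ihl ihr =>
    obtain ⟨hl, hr, hlr, -, -⟩ := isValid_node.1 ht
    by_cases hx : x ∈ A
    · exact (ht.reachable_root hx ha).trans (ht.reachable_root hx hb).symm
    · rcases a with _ | ⟨_ | _, a⟩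
      · exact absurd ha hx
      · rcases b with _ | ⟨_ | _, b⟩
        · exact absurd hb hx
        · exact (ihl hl ha hb).map (copyGraphHomLeft A l r)
        · exact absurd (hlr ⟨mem_support_of_mem_bagAt (t := l) ha,
            mem_support_of_mem_bagAt (t := r) hb⟩) hx
      · rcases b with _ | ⟨_ | _, b⟩
        · exact absurd hb hx
        · exact absurd (hlr ⟨mem_support_of_mem_bagAt (t := l) hb,
            mem_support_of_mem_bagAt (t := r) ha⟩) hx
        · exact (ihr hr ha hb).map (copyGraphHomRight A l r)

theorem eq_of_copyGraph_reachable {t : BagTree α} {p q : t.Point} (h : t.copyGraph.Reachable p q) :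
    p.1.2 = q.1.2 := by
  obtain ⟨w⟩ := h
  induction w with
  | nil => rfl
  | cons h _ ih => exact h.1.trans ih

theorem IsValid.isMinor_hostGraph {t : BagTree α} (ht : t.IsValid) {G : SimpleGraph α}
    (hs : t.support = Set.univ) (he : ∀ x y, G.Adj x y → ∃ B ∈ t.bags, x ∈ B ∧ y ∈ B) :
    G.IsMinor (t.hostGraph G) := by
  refine SimpleGraph.isMinor_of_fibers (F := t.copyGraph) (f := fun p => p.1.2)
    (fun p q h => Or.inr h) ?_ ?_ ?_
  · intro x
    obtain ⟨a, ha⟩ := exists_mem_bagAt (t := t) (hs ▸ Set.mem_univ x)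
    exact ⟨⟨(a, x), ha⟩, rfl⟩
  · refine fun p q => ⟨eq_of_copyGraph_reachable, ?_⟩
    obtain ⟨⟨a, x⟩, ha⟩ := p
    obtain ⟨⟨b, y⟩, hb⟩ := q
    rintro ⟨⟩
    exact ht.reachable ha hb
  · intro x y
    constructor
    · intro h
      obtain ⟨B, hB, hx, hy⟩ := he x y h
      obtain ⟨a, -, rfl⟩ := mem_bags_iff.1 hB
      exact ⟨h.ne, ⟨(a, x), hx⟩, ⟨(a, y), hy⟩, rfl, rfl, Or.inl ⟨rfl, h⟩⟩
    · rintro ⟨hne, p, q, rfl, rfl, h | h⟩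
      · exact h.2
      · exact absurd h.1 hne

/-- Each edge of the host graph stays at a node or moves to a neighbouring one. -/
theorem addressDist_le_of_walk {t : BagTree α} {G : SimpleGraph α} (c : List Bool) {p q : t.Point}
    (w : (t.hostGraph G).Walk p q) :
    addressDist c q.1.1 ≤ addressDist c p.1.1 + w.length := by
  induction w with
  | nil => simp
  | @cons p q _ h w ih =>
    have : addressDist c q.1.1 ≤ addressDist c p.1.1 + 1 := by
      rcases h with ⟨h, -⟩ | ⟨-, ⟨b, h⟩ | ⟨b, h⟩⟩
      · rw [h]
        omega
      · rw [h]
        exact (addressDist_concat c _ b).1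
      · rw [h]
        exact (addressDist_concat c _ b).2
    rw [SimpleGraph.Walk.length_cons]
    omega

theorem encard_points_le {t : BagTree α} {k : ℕ} (hk : ∀ B ∈ t.bags, B.encard ≤ k)
    (P : List Bool → Prop) [DecidablePred P] :
    {p : t.Point | P p.1.1}.encard ≤ (t.count P * k : ℕ) := by
  have hsub : Subtype.val '' {p : t.Point | P p.1.1} ⊆
      ⋃ a ∈ t.addresses.filter P, Prod.mk a '' t.bagAt a := by
    rintro _ ⟨⟨⟨a, x⟩, hx⟩, ha, rfl⟩
    simp only [Set.mem_iUnion]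
    exact ⟨a, Finset.mem_filter.2 ⟨mem_addresses_of_mem_bagAt hx, ha⟩, x, hx, rfl⟩
  rw [← Subtype.val_injective.encard_image]
  refine (Set.encard_le_encard hsub).trans ?_
  have hle (s : Finset (List Bool)) (hs : s ⊆ t.addresses) :
      (⋃ a ∈ s, Prod.mk a '' t.bagAt a).encard ≤ (s.card * k : ℕ) := by
    induction s using Finset.induction_on with
    | empty => simp
    | insert a s ha ih =>
      rw [Finset.set_biUnion_insert, Finset.card_insert_of_notMem ha]
      refine (Set.encard_union_le _ _).trans ?_
      have h1 := ih fun b hb => hs (Finset.mem_insert_of_mem hb)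
      have h2 := hk _ (mem_bags_iff.2 ⟨a, hs (Finset.mem_insert_self a s), rfl⟩)
      rw [← (Prod.mk_right_injective a).encard_image] at h2
      refine (add_le_add h2 h1).trans (le_of_eq ?_)
      push_cast
      ring
  exact hle _ (Finset.filter_subset _ _)

instance finite_point [Finite α] (t : BagTree α) : Finite t.Point := by
  let f : t.Point → t.addresses × α :=
    fun p => (⟨p.1.1, mem_addresses_of_mem_bagAt p.2⟩, p.1.2)
  refine Finite.of_injective f ?_
  rintro ⟨⟨a, x⟩, _⟩ ⟨⟨b, y⟩, _⟩ h
  simpa [f] using h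

theorem LinearGrowth.growth_hostGraph_le {t : BagTree α} (ht : t.LinearGrowth) {k : ℕ}
    (hk : ∀ B ∈ t.bags, B.encard ≤ k) (G : SimpleGraph α) (r : ℕ) :
    (t.hostGraph G).growth r ≤ ((5 * r + 1) * k : ℕ) := by
  refine iSup₂_le fun H hH => ?_
  rcases H.verts.eq_empty_or_nonempty with h | h
  · simp [h]
  have : Nonempty H.verts := h.to_subtype
  obtain ⟨c, hc⟩ := H.coe.exists_eccent_eq_radius
  have hd (q : H.verts) : addressDist c.1.1.1 q.1.1.1 ≤ r := by
    have h1 : H.coe.edist c q ≤ r := (SimpleGraph.edist_le_eccent.trans hc.le).trans hH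
    have h2 : H.coe.edist c q ≠ ⊤ := ne_top_of_le_ne_top (ENat.natCast_ne_top r) h1
    obtain ⟨w, hw⟩ := SimpleGraph.exists_walk_of_edist_ne_top h2
    have h3 := addressDist_le_of_walk c.1.1.1 (w.map H.hom)
    rw [SimpleGraph.Walk.length_map] at h3
    rw [← hw, Nat.cast_le] at h1
    have h4 : addressDist c.1.1.1 (H.hom c).1.1 = 0 := addressDist_self _
    exact (h3.trans (by omega : _ ≤ w.length)).trans h1
  have hsub : H.verts ⊆ {p : t.Point | addressDist c.1.1.1 p.1.1 ≤ r} := fun q hq => hd ⟨q, hq⟩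
  refine ((Set.encard_le_encard hsub).trans (encard_points_le hk (addressDist c.1.1.1 · ≤ r))).trans ?_
  have := ht c.1.1.1 (mem_addresses_of_mem_bagAt c.1.2) r
  exact_mod_cast Nat.mul_le_mul_right k ((Nat.le_add_right _ _).trans this)

end BagTree

/-! ### From tree-decompositions to binary trees -/

namespace SimpleGraph

/-- In a rooted tree, the path from the root to a node of a subtree `C` enters `C` at a node `c`
that is closest to the root, and then stays in `C`. -/
theorem IsTree.exists_gate {N : Type v} {T : SimpleGraph N} (hT : T.IsTree) (o : N) {C : Set N}
    (hC : (T.induce C).Connected) :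
    ∃ c ∈ C, ∀ p ∈ C, ∃ R : T.Path o p,
      c ∈ R.1.support ∧ ∀ q ∈ R.1.support, q ∈ C ∨ T.dist o q < T.dist o c := by
  have hne : C.Nonempty := Set.nonempty_coe_sort.1 hC.nonempty
  obtain ⟨c, hc, hmin⟩ := exists_minimalFor_of_wellFoundedLT (· ∈ C) (T.dist o) hne
  replace hmin (q : N) (hq : q ∈ C) : T.dist o c ≤ T.dist o q :=
    (le_total _ _).elim id (hmin hq)
  refine ⟨c, hc, fun p hp => ?_⟩
  obtain ⟨P, hP, hlen⟩ := hT.connected.exists_path_of_dist o c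
  obtain ⟨Q₀, hQ₀⟩ := (hC.preconnected ⟨c, hc⟩ ⟨p, hp⟩).exists_isPath
  let Q : T.Walk c p := Q₀.map (Embedding.induce C).toHom
  have hQ : Q.IsPath := hQ₀.map Subtype.val_injective
  have hQC (q : N) (hq : q ∈ Q.support) : q ∈ C := by
    have hQs : Q.support = Q₀.support.map Subtype.val := Walk.support_map _ _
    rw [hQs, List.mem_map] at hq
    obtain ⟨q, -, rfl⟩ := hq
    exact q.2
  have hPC (q : N) (hq : q ∈ P.support) (hqc : q ≠ c) : T.dist o q < T.dist o c := by
    classical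
    rw [← hlen]
    exact (dist_le _).trans_lt (Walk.length_takeUntil_lt_length hq hqc)
  have hR : (P.append Q).IsPath := by
    rw [Walk.isPath_def, Walk.support_append]
    refine List.Nodup.append hP.support_nodup hQ.support_nodup.tail ?_
    intro q hqP hqQ
    have hqc : q ≠ c := by
      rintro rfl
      have := hQ.support_nodup
      rw [← Walk.cons_tail_support, List.nodup_cons] at this
      exact this.1 hqQ
    exact (hmin q (hQC q (List.mem_of_mem_tail hqQ))).not_gt (hPC q hqP hqc)
  refine ⟨⟨P.append Q, hR⟩, ?_, ?_⟩
  · simp [Walk.mem_support_append_iff]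
  · intro q hq
    rcases (Walk.mem_support_append_iff _ _).1 hq with hq | hq
    · by_cases hqc : q = c
      · exact Or.inl (hqc ▸ hc)
      · exact Or.inr (hPC q hq hqc)
    · exact Or.inl (hQC q hq)

/-- Every vertex has a top node, and if the subtrees of two vertices meet, then the top node of the
one that is lower lies in both. -/
theorem TreeDecomposition.exists_top {V : Type u} {G : SimpleGraph V} {N : Type v}
    {T : SimpleGraph N} (D : G.TreeDecomposition T) :
    ∃ (top : V → N) (depth : V → ℕ), (∀ x, x ∈ D.bag (top x)) ∧
      ∀ x y p, x ∈ D.bag p → y ∈ D.bag p → depth y ≤ depth x → y ∈ D.bag (top x) := by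
  obtain ⟨o⟩ := D.isTree.connected.nonempty
  choose top htop hgate using fun x => D.isTree.exists_gate o (D.connected_nodes x)
  refine ⟨top, fun x => T.dist o (top x), htop, fun x y p hx hy h => ?_⟩
  obtain ⟨R, hR, -⟩ := hgate x p hx
  obtain ⟨R', -, hR'⟩ := hgate y p hy
  -- By uniqueness of paths, the top node of `x` lies on the path that enters the subtree of `y`; it
  -- is not above the entry point, so it is in that subtree.
  rw [(D.isTree.isAcyclic.subsingleton_path o p).elim R R'] at hR
  exact (hR' _ hR).resolve_right h.not_gt

/-- The bags of a tree-decomposition of a finite graph can be arranged in a binary tree. -/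
theorem TreeDecomposition.exists_bagTree {V : Type u} [Finite V] {G : SimpleGraph V} {N : Type v}
    {T : SimpleGraph N} (D : G.TreeDecomposition T) :
    ∃ t : BagTree V, t.IsValid ∧ (∀ B ∈ t.bags, ∃ p, B ⊆ D.bag p) ∧
      ∀ p, ∃ B ∈ t.bags, D.bag p ⊆ B := by
  classical
  have := Fintype.ofFinite V
  obtain ⟨o⟩ := D.isTree.connected.nonempty
  obtain ⟨top, depth, htop, hkey⟩ := D.exists_top
  suffices h : ∀ U : Finset V, ∃ t : BagTree V, t.IsValid ∧ t.support = U ∧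
      (∀ B ∈ t.bags, ∃ p, B ⊆ D.bag p) ∧ ∀ p, ∃ B ∈ t.bags, ↑U ∩ D.bag p ⊆ B by
    obtain ⟨t, h1, -, h2, h3⟩ := h Finset.univ
    exact ⟨t, h1, h2, by simpa using h3⟩
  intro U
  -- The added vertex `x` has maximal depth, so every earlier vertex sharing a bag with `x` lies in
  -- the bag of `top x`. The new bag, `x` with the earlier part of that bag, therefore covers all
  -- bags containing `x`.
  induction U using Finset.induction_on_max_value depth with
  | empty =>
    -- A node with empty bag, not the empty tree: the first leaf needs a place to be attached.
    refine ⟨.node ∅ .empty .empty, ?_, ?_, ?_, ?_⟩ <;> simp [BagTree.isValid_node]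
    exact ⟨o⟩
  | insert x U hx hmax ih =>
    obtain ⟨t, ht, hU, hb, hcov⟩ := ih
    obtain ⟨Y, hY, hXY⟩ := hcov (top x)
    obtain ⟨t', ht', -, hbags⟩ := ht.exists_attach hY hXY (x := x) (by simpa [hU] using hx)
    refine ⟨t', ht', ?_, ?_, ?_⟩
    · have hsub : ↑U ∩ D.bag (top x) ⊆ t.support := hU ▸ Set.inter_subset_left
      rw [BagTree.support, hbags, Set.sUnion_insert, ← BagTree.support, Set.insert_union,
        Set.union_eq_self_of_subset_left hsub, hU, Finset.coe_insert]
    · rw [hbags]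
      rintro B (rfl | hB)
      · exact ⟨top x, Set.insert_subset (htop x) Set.inter_subset_right⟩
      · exact hb B hB
    · intro p
      rw [hbags]
      by_cases hxp : x ∈ D.bag p
      · refine ⟨_, Set.mem_insert _ _, ?_⟩
        rintro y ⟨hy, hyp⟩
        rcases Finset.mem_insert.1 hy with rfl | hy
        · exact Set.mem_insert _ _
        · exact Or.inr ⟨hy, hkey x y p hxp hyp (hmax y hy)⟩
      · obtain ⟨B, hB, h⟩ := hcov p
        refine ⟨B, Set.mem_insert_of_mem _ hB, ?_⟩
        rintro y ⟨hy, hyp⟩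
        rcases Finset.mem_insert.1 hy with rfl | hy
        · exact absurd hyp hxp
        · exact h ⟨hy, hyp⟩

theorem exists_treeDecomposition_of_treewidth_lt {V : Type u} {G : SimpleGraph V} {k : ℕ}
    (h : G.treewidth < k) :
    ∃ (N : Type u) (T : SimpleGraph N) (D : G.TreeDecomposition T),
      ∀ p, (D.bag p).encard ≤ k := by
  simp only [treewidth, iInf_lt_iff] at h
  obtain ⟨N, T, D, h⟩ := h
  refine ⟨N, T, D, fun p => (le_iSup (fun p => (D.bag p).encard) p).trans ?_⟩
  -- Truncated subtraction is harmless here: the supremum is always at most the width plus one.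
  rw [TreeDecomposition.width] at h
  exact tsub_le_iff_right.1 le_rfl |>.trans (Order.add_one_le_of_lt h)

/-- Relabel the vertices of a tree-decomposition. -/
def TreeDecomposition.comap {V V' : Type*} {G : SimpleGraph V} {N : Type*}
    {T : SimpleGraph N} (D : G.TreeDecomposition T) (f : V' → V) :
    (G.comap f).TreeDecomposition T where
  isTree := D.isTree
  bag p := f ⁻¹' D.bag p
  exists_bag_of_adj _ _ h := D.exists_bag_of_adj h
  connected_nodes x := D.connected_nodes (f x)

end SimpleGraph

/-! ### The main theorem -/

theorem mainTheorem9 (k : ℕ) (hk : 1 ≤ k) (ε : ℝ) (hε : 0 < ε)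
    {V : Type u} [Finite V] (G : SimpleGraph V) (hG : G.treewidth < (k : ℕ∞)) :
    ∃ (W : Type) (_ : Finite W) (G' : SimpleGraph W),
      G.IsMinor G' ∧
      ∀ r : ℕ, 1 ≤ r →
        (G'.growth r : ℝ≥0∞) ≤ ENNReal.ofReal ((162 * ((k : ℝ) + 1) + ε) * (r : ℝ) + 1) := by
  obtain ⟨N, T, D, hD⟩ := SimpleGraph.exists_treeDecomposition_of_treewidth_lt hG
  -- Relabelling by `Fin` brings the host graph's vertices down to `Type`.
  let e : Fin (Nat.card V) ≃ V := (Finite.equivFin V).symm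
  obtain ⟨t, ht, hb, hcov⟩ := (D.comap e).exists_bagTree
  have hbags : ∀ B ∈ t.stretch.bags, B.encard ≤ k := by
    intro B hB
    rw [t.bags_stretch] at hB
    obtain ⟨p, hp⟩ := hb B hB
    refine (Set.encard_le_encard hp).trans (le_trans (le_of_eq ?_) (hD p))
    exact Set.encard_preimage_of_bijective e.bijective _
  refine ⟨t.stretch.Point, inferInstance, t.stretch.hostGraph (G.comap e), ?_, fun r hr => ?_⟩
  · refine SimpleGraph.IsMinor.of_iso (SimpleGraph.Iso.comap e G).symm ?_
    refine ht.stretch.isMinor_hostGraph ?_ fun x y h => ?_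
    · refine Set.eq_univ_of_forall fun x => ?_
      obtain ⟨⟨p, hp⟩⟩ := (D.connected_nodes (e x)).nonempty
      obtain ⟨B, hB, hpB⟩ := hcov p
      exact ⟨B, t.bags_stretch ▸ hB, hpB hp⟩
    · obtain ⟨p, hx, hy⟩ := (D.comap e).exists_bag_of_adj h
      obtain ⟨B, hB, hpB⟩ := hcov p
      exact ⟨B, t.bags_stretch ▸ hB, hpB hx, hpB hy⟩
  · have h1 := t.linearGrowth_stretch.growth_hostGraph_le hbags (G.comap e) r
    have h2 : ((t.stretch.hostGraph (G.comap e)).growth r : ℝ≥0∞) ≤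
        (((5 * r + 1) * k : ℕ) : ℝ≥0∞) := by
      simpa using ENat.toENNReal_le.2 h1
    refine h2.trans ?_
    rw [← ENNReal.ofReal_natCast]
    refine ENNReal.ofReal_le_ofReal ?_
    have hr' : (1 : ℝ) ≤ r := by exact_mod_cast hr
    have hk' : (1 : ℝ) ≤ k := by exact_mod_cast hk
    push_cast
    -- Since r ≥ 1, (5r + 1)k ≤ 6kr.
    have h3 : (k : ℝ) ≤ k * r := le_mul_of_one_le_right (by positivity) hr'
    have h4 : 0 ≤ ε * r := by positivity
    nlinarith
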